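/- Let $q,M,\mu,n,r,s,d$ be positive integers with $q$ a prime power, $r\le n$, $s\le (n-r)(\mu-1)$ and $n-r\le d\le n-1$. Put $b=d+1-(n-r)$ and $\ell=b^n$. Let $\beta_{i,j}\in\mathbb F_q$ ($1\le i\le n$, $0\le j\le b-1$) be pairwise distinct (so $q\ge bn$), and let $\alpha_{i,j}\in\mathbb F_{q^M}$ ($1\le i\le\mu$, $1\le j\le n$) be such that any at most $(r+1)s$ of the $\alpha_{i,j}$ (as an indexed family) are linearly independent over $\mathbb F_q$. For $0\le a\le \ell-1$ write $a=\sum_{i=1}^n a_i b^{i-1}$ with $0\le a_i\le b-1$, and let $$H_0^{(a)}=\big(\beta_{i,a_i}^{\,t}\big)_{0\le t\le r-1,\ 1\le i\le n},\qquad H_j=\big(\alpha_{j,k}^{\,q^t}\big)_{0\le t\le s-1,\ 1\le k\le n},$$ $$H^{(a)}=\begin{pmatrix}H_0^{(a)}&&\\&\ddots&\\&&H_0^{(a)}\\H_1&\cdots&H_\mu\end{pmatrix}\in\mathbb F_{q^M}^{(r\mu+s)\times\mu n}.$$ Let $\mathcal C\subseteq \mathbb F_{q^M}^{\ell\times\mu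 n}$ be the code of all arrays whose rows $c^{(0)},\dots,c^{(\ell-1)}$ satisfy $H^{(a)}c^{(a)}=0$ for all $a$, and let $W_i$ be the $i$-th block of $n$ consecutive positions, $1\le i\le\mu$. An $[N,k,\delta;\ell]$ code is a linear code of $\ell\times N$ arrays over $\mathbb F_{q^M}$ of dimension $\ell k$ over $\mathbb F_{q^M}$, whose minimum number of nonzero columns of a nonzero codeword is $\delta$; it is MDS if $\delta=N-k+1$. Write $\mathcal C|_R$ for the restriction of $\mathcal C$ to the columns in $R$. Then $\mathcal C$ is a locally $d$-MSR $\mathsf{PMDS}(\mu n,\mu,n,r,s;\ell)$ array code with partition $\{W_1,\dots,W_\mu\}$, that is: 1. $\dim_{\mathbb F_{q^M}}\mathcal C=\ell\,((n-r)\mu-s)$; 2. $\mathcal C|_{W_i}$ is an $[n,n-r,r+1;\ell]$ MDS code for every $i$; 3. for all $E_i\subseteq W_i$ with $|E_i|=r$ ($1\le i\le \mu$), the code $\mathcal C|_{[\mu n]\setminus\bigcup_i E_i}$ is an $[(n-r)\mu,(n-r)\mu-s,s+1;\ell]$ MDS code; 4. every local code $\mathcal C|_{W_i}$ is $d$-MSR: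 the maximum, over all $f\in W_i$ and all $R\subseteq W_i\setminus\{f\}$ with $|R|=d$, of the smallest total number of symbols of $\mathbb F_{q^M}$ that have to be downloaded from the columns in $R$ (each column sending symbols that are a function of its own content) in order to recover column $f$ of every codeword equals $d\ell/(d+1-n+r)$. Moreover each $\mathcal C|_{W_i}$ is the Ye--Barg code of all arrays in $\mathbb F_{q^M}^{\ell\times n}$ whose $a$-th row lies in the kernel of $H_0^{(a)}$ for all $a$. -/

import Mathlib

open Matrix

section ArrayCodes

variable {K : Type*} [Field K] {ℓ : ℕ} {ι κ : Type*}

/-- Re-indexing the columns of an array along a map `f`; for an injective `f` this keeps the columns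
in the range of `f` and deletes all the others. -/
def columnMap (K : Type*) [Field K] (ℓ : ℕ) (f : κ → ι) :
    Matrix (Fin ℓ) ι K →ₗ[K] Matrix (Fin ℓ) κ K where
  toFun c := c.submatrix id f
  map_add' _ _ := rfl
  map_smul' _ _ := rfl

/-- The restriction `C|_R` of an array code to the positions in `R` (puncturing outside `R`). -/
def restrictCode (C : Submodule K (Matrix (Fin ℓ) ι K)) (R : Finset ι) :
    Submodule K (Matrix (Fin ℓ) R K) :=
  C.map (columnMap K ℓ (fun j : R => (j : ι)))

/-- The number of nonzero columns of an array, i.e. its Hamming weight as a word whose symbols are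
the columns. -/
noncomputable def columnWeight (c : Matrix (Fin ℓ) ι K) : ℕ :=
  Set.ncard {j : ι | ∃ a, c a j ≠ 0}

/-- `C` is an `[N, k, δ; ℓ]` array code: a `K`-linear code of length `N` whose symbols are columns in
`K ^ ℓ`, with `|K| ^ (ℓ * k)` codewords and minimum (column) distance `δ`. -/
def IsArrayCode [Fintype ι] (C : Submodule K (Matrix (Fin ℓ) ι K)) (N k δ : ℕ) : Prop :=
  Fintype.card ι = N ∧ Module.finrank K C = ℓ * k ∧
    IsLeast {w : ℕ | ∃ c ∈ C, c ≠ 0 ∧ w = columnWeight c} δ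

/-- `C` is an `[N, k, δ; ℓ]` MDS array code: the Singleton bound `δ ≤ N - k + 1` is an equality. -/
def IsMDSArrayCode [Fintype ι] (C : Submodule K (Matrix (Fin ℓ) ι K)) (N k δ : ℕ) : Prop :=
  IsArrayCode C N k δ ∧ k + δ = N + 1

/-- The nodes in `F` can be recovered by downloading `m` symbols of `K` in total from the nodes in
`R`: node `i ∈ R` sends `t i` symbols, an arbitrary function `f i` of its own column, and the columns
in `F` are a function `g` of everything that is sent. -/
def CanRepair (C : Submodule K (Matrix (Fin ℓ) ι K)) (F R : Finset ι) (m : ℕ) : Prop :=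
  ∃ (t : R → ℕ) (f : ∀ i : R, (Fin ℓ → K) → (Fin (t i) → K))
    (g : (∀ i : R, Fin (t i) → K) → (F → Fin ℓ → K)),
    ∑ i, t i = m ∧
      ∀ c ∈ C, ∀ j : F, g (fun i => f i (fun a => c a i)) j = fun a => c a j

/-- `M(C, F, R)`: the smallest number of symbols one needs to download from the nodes in `R` to
recover the nodes in `F`. -/
noncomputable def repairBandwidth (C : Submodule K (Matrix (Fin ℓ) ι K)) (F R : Finset ι) : ℕ :=
  sInf {m : ℕ | CanRepair C F R m}

/-- `C` is an `(h, d)`-MSR code: an `[n, n - r, r + 1; ℓ]` MDS array code for which the maximum of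
`M(C, F, R)` over disjoint `F`, `R` with `|F| = h`, `|R| = d` is `h d ℓ / (h + d - n + r)`.
The side conditions `h ≤ r` and `n - r ≤ d` guarantee that the minimum in `M(C, F, R)` is over a
nonempty set. -/
def IsMSR [Fintype ι] (C : Submodule K (Matrix (Fin ℓ) ι K)) (n r h d : ℕ) : Prop :=
  r ≤ n ∧ 1 ≤ h ∧ h ≤ r ∧ n - r ≤ d ∧ IsMDSArrayCode C n (n - r) (r + 1) ∧
    IsGreatest
      {x : ℚ | ∃ F R : Finset ι, F.card = h ∧ R.card = d ∧ Disjoint F R ∧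
        x = (repairBandwidth C F R : ℚ)}
      ((h : ℚ) * d * ℓ / ((h : ℚ) + d - n + r))

/-- `C` is a `PMDS(μ n, μ, n, r, s; ℓ)` partial MDS array code with partition `W` of its positions
into local groups. -/
structure IsPMDSWith [Fintype ι] [DecidableEq ι] {μ : ℕ} (C : Submodule K (Matrix (Fin ℓ) ι K))
    (W : Fin μ → Finset ι) (n r s : ℕ) : Prop where
  pos_mu : 0 < μ
  pos_n : 0 < n
  pos_r : 0 < r
  pos_s : 0 < s
  pos_l : 0 < ℓ
  r_le : r ≤ n
  s_le : s ≤ (n - r) * μ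
  length_eq : Fintype.card ι = μ * n
  finrank_eq : Module.finrank K C = ℓ * ((n - r) * μ - s)
  disjoint : Pairwise fun i j => Disjoint (W i) (W j)
  cover : ∀ x, ∃ i, x ∈ W i
  card_group : ∀ i, (W i).card = n
  local_mds : ∀ i, IsMDSArrayCode (restrictCode C (W i)) n (n - r) (r + 1)
  global_mds : ∀ E : Fin μ → Finset ι, (∀ i, E i ⊆ W i ∧ (E i).card = r) →
    IsMDSArrayCode (restrictCode C (Finset.univ.biUnion E)ᶜ)
      ((n - r) * μ) ((n - r) * μ - s) (s + 1)

/-- `C` is a locally `(h, d)`-MSR `PMDS(μ n, μ, n, r, s; ℓ)` code with partition `W`. -/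
def IsLocallyMSRPMDSWith [Fintype ι] [DecidableEq ι] {μ : ℕ}
    (C : Submodule K (Matrix (Fin ℓ) ι K)) (W : Fin μ → Finset ι) (n r s h d : ℕ) : Prop :=
  IsPMDSWith C W n r s ∧ ∀ i, IsMSR (restrictCode C (W i)) n r h d

end ArrayCodes

section Construction

variable {F K : Type*} [Field F] [Field K] {μ n b : ℕ}

/-- The `r × n` matrix with entries `β_{k, a_k} ^ t`, where `a_k` are the base-`b` digits of the
row number `a`, least significant digit first (`a = ∑ a_k b ^ k`, everything indexed from `0`). -/
def yeBargParity (r : ℕ) (β : Fin n → Fin b → F) (a : Fin (b ^ n)) : Matrix (Fin r) (Fin n) F :=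
  Matrix.of fun t k => β k (finFunctionFinEquiv.symm a k) ^ (t : ℕ)

/-- The Ye--Barg array code: row `a` of every codeword is in the kernel of `yeBargParity r β a`. -/
def yeBargCode (r : ℕ) (β : Fin n → Fin b → F) : Submodule F (Matrix (Fin (b ^ n)) (Fin n) F) where
  carrier := {c | ∀ a, yeBargParity r β a *ᵥ c a = 0}
  add_mem' {x y} hx hy a := by
    have h : (x + y) a = x a + y a := rfl
    rw [h, Matrix.mulVec_add, hx a, hy a, add_zero]
  zero_mem' a := by
    have h : (0 : Matrix (Fin (b ^ n)) (Fin n) F) a = 0 := rfl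
    rw [h, Matrix.mulVec_zero]
  smul_mem' u x hx a := by
    have h : (u • x) a = u • x a := rfl
    rw [h, Matrix.mulVec_smul, hx a, smul_zero]

/-- The `(r μ + s) × μ n` matrix `H^(a)`. Position `(j, k)` is the `k`-th position of the `j`-th local
group. The first `μ` blocks of `r` rows are block diagonal with all diagonal blocks equal to the
Ye--Barg matrix of row `a`; the last `s` rows are the Frobenius powers `α_{j, k} ^ (q ^ t)`. -/
def pmdsParity [Algebra F K] (q r s : ℕ) (β : Fin n → Fin b → F) (α : Fin μ → Fin n → K)
    (a : Fin (b ^ n)) : Matrix ((Fin μ × Fin r) ⊕ Fin s) (Fin μ × Fin n) K :=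
  Matrix.of fun x p =>
    match x with
    | Sum.inl y => if y.1 = p.1 then algebraMap F K (yeBargParity r β a y.2 p.2) else 0
    | Sum.inr t => α p.1 p.2 ^ (q ^ (t : ℕ))

/-- The array code with `b ^ n` rows whose row `a` is in the kernel of `H^(a)`, for every `a`. -/
def pmdsCode [Algebra F K] (q r s : ℕ) (β : Fin n → Fin b → F) (α : Fin μ → Fin n → K) :
    Submodule K (Matrix (Fin (b ^ n)) (Fin μ × Fin n) K) where
  carrier := {c | ∀ a, pmdsParity q r s β α a *ᵥ c a = 0}
  add_mem' {x y} hx hy a := by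
    have h : (x + y) a = x a + y a := rfl
    rw [h, Matrix.mulVec_add, hx a, hy a, add_zero]
  zero_mem' a := by
    have h : (0 : Matrix (Fin (b ^ n)) (Fin μ × Fin n) K) a = 0 := rfl
    rw [h, Matrix.mulVec_zero]
  smul_mem' u x hx a := by
    have h : (u • x) a = u • x a := rfl
    rw [h, Matrix.mulVec_smul, hx a, smul_zero]

/-- The `i`-th local group of positions. -/
def localGroup (μ n : ℕ) (i : Fin μ) : Finset (Fin μ × Fin n) :=
  Finset.univ.filter fun p => p.1 = i

end Construction

/-! Everything rests on one fact about a single row `a`: in `H^(a)`, any `r` columns from each local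
group together with any `s` further columns are linearly independent. Let `E` be the chosen `r`-sets
and `T` the further positions. A vector supported on `E ∪ T` and killed by the local rows is
determined by its values on `T`, since the `r × r` Vandermonde blocks on `E` are invertible. It is
the combination, with these values as coefficients, of vectors `V τ` with entries in `F`, where `V
τ` lives on `τ` and the `r` erased positions of its group. As Frobenius is `F`-linear, the last `s`
rows become a Moore system in the elements `∑ p, V τ p • α p`. These involve at most `(r + 1) s` of
the `α` and inherit their `F`-independence, so the Moore system has only the zero solution.

Such a choice has `μ r + s` columns, as many as there are rows, so it is an invertible square
submatrix. This gives the dimension and the MDS property after puncturing `r` positions per group.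
Since `s ≤ (n - r)(μ - 1)`, the `s` further columns can avoid one group entirely; a Ye–Barg word on
that group then extends to a codeword, so the local code is the full Ye–Barg code.

For repair of column `j`, add the parity equations of the `b` rows differing only in digit `j`.
Column `j` contributes `b` unknowns with distinct nodes, while every other column keeps its node and
contributes one digit sum. With the `d` helper sums known, `b + (n - d - 1) = r` unknowns remain in
`r` Vandermonde equations. Each helper sends `b ^ (n - 1)` symbols, which the cut-set bound shows to
be optimal. -/

/-- A vector in the kernel of a Vandermonde matrix with distinct nodes and at least as many rows as
the size of the support is zero. -/
theorem eq_zero_of_sum_pow_mul_eq_zero {K ι : Type*} [Field K] {S : Finset ι} {x : ι → K}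
    (hx : Set.InjOn x S) {r : ℕ} (hS : S.card ≤ r) {c : ι → K}
    (h : ∀ t < r, ∑ i ∈ S, x i ^ t * c i = 0) : ∀ i ∈ S, c i = 0 := by
  classical
  intro i hi
  -- Lagrange polynomial: it kills every node of `S` except `x i` and has degree `|S| - 1 < r`, so
  -- the given power sums combine to `p (x i) * c i = 0`.
  set p : Polynomial K := ∏ j ∈ S.erase i, (Polynomial.X - Polynomial.C (x j)) with hp
  have hdeg : p.natDegree < r := by
    rw [hp, Polynomial.natDegree_finsetProd_X_sub_C_eq_card, Finset.card_erase_of_mem hi]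
    have := Finset.card_pos.2 ⟨i, hi⟩
    omega
  have hsum : ∑ j ∈ S, p.eval (x j) * c j = 0 := by
    simp_rw [Polynomial.eval_eq_sum_range' hdeg, Finset.sum_mul]
    rw [Finset.sum_comm]
    refine Finset.sum_eq_zero fun t ht => ?_
    simp_rw [mul_assoc]
    rw [← Finset.mul_sum, h t (Finset.mem_range.1 ht), mul_zero]
  rw [Finset.sum_eq_single_of_mem i hi] at hsum
  · refine (mul_eq_zero.1 hsum).resolve_left ?_
    rw [hp, Polynomial.eval_prod]
    refine Finset.prod_ne_zero_iff.2 fun j hj => ?_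
    rw [Polynomial.eval_sub, Polynomial.eval_X, Polynomial.eval_C, sub_ne_zero]
    exact fun e => (Finset.mem_erase.1 hj).1 (hx (Finset.mem_of_mem_erase hj) hi e.symm)
  · intro j hj hji
    have : p.eval (x j) = 0 := by
      rw [hp, Polynomial.eval_prod]
      exact Finset.prod_eq_zero (Finset.mem_erase.2 ⟨hji, hj⟩) (by simp)
    rw [this, zero_mul]

/-! ### Vectors with prescribed support. -/

section Supported

variable {K m ι : Type*} [Field K]

/-- The restriction of a matrix, as a linear map, to the vectors supported in `S`. -/
noncomputable def supportedMulVec [Fintype ι] (A : Matrix m ι K) (S : Finset ι) : (S → K) →ₗ[K] (m → K) :=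
  A.mulVecLin ∘ₗ Function.ExtendByZero.linearMap K (Subtype.val : S → ι)

theorem extend_val_eq_zero {S : Finset ι} (c : S → K) {i : ι} (hi : i ∉ S) :
    Function.extend (Subtype.val : S → ι) c 0 i = 0 :=
  Function.extend_apply' _ _ _ (by rintro ⟨a, rfl⟩; exact hi a.2)

theorem extend_val_eq_zero_iff {S : Finset ι} (c : S → K) :
    Function.extend (Subtype.val : S → ι) c 0 = 0 ↔ c = 0 := by
  constructor
  · intro h
    ext i
    have := congrFun h i
    rwa [Subtype.val_injective.extend_apply] at this
  · rintro rfl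
    exact Function.extend_zero _

/-- The columns in `S` form a square matrix, so injectivity makes it invertible. -/
theorem exists_supported_mulVec_eq [Fintype m] [Fintype ι] {A : Matrix m ι K} {S : Finset ι}
    (hS : S.card = Fintype.card m)
    (h : ∀ c : ι → K, (∀ i ∉ S, c i = 0) → A *ᵥ c = 0 → c = 0) (y : m → K) :
    ∃ c : ι → K, (∀ i ∉ S, c i = 0) ∧ A *ᵥ c = y := by
  have hinj : Function.Injective (supportedMulVec A S) := by
    rw [injective_iff_map_eq_zero]
    intro c hc
    exact (extend_val_eq_zero_iff c).1 (h _ (fun i hi => extend_val_eq_zero c hi) hc)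
  have hsurj := (LinearMap.injective_iff_surjective_of_finrank_eq_finrank (by simp [hS])).1 hinj
  obtain ⟨c, hc⟩ := hsurj y
  exact ⟨_, fun i hi => extend_val_eq_zero c hi, hc⟩

theorem exists_supported_mulVec_eq_zero [Fintype m] [Fintype ι] (A : Matrix m ι K) {S : Finset ι}
    (hS : Fintype.card m < S.card) :
    ∃ c : ι → K, (∀ i ∉ S, c i = 0) ∧ A *ᵥ c = 0 ∧ c ≠ 0 := by
  have hker : (supportedMulVec A S).ker ≠ ⊥ := LinearMap.ker_ne_bot_of_finrank_lt (by simpa)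
  obtain ⟨c, hc, hc0⟩ := Submodule.exists_mem_ne_zero_of_ne_bot hker
  exact ⟨_, fun i hi => extend_val_eq_zero c hi, hc, fun h => hc0 ((extend_val_eq_zero_iff c).1 h)⟩

end Supported

/-! ### Moore matrices over finite fields. -/

section Moore

/-- `X ^ |F| - X` has at most `|F|` roots, and the image of `F` already supplies that many. -/
theorem FiniteField.exists_algebraMap_eq_of_pow_card_eq {F K : Type*} [Field F] [Fintype F]
    [Field K] [Algebra F K] {x : K} (hx : x ^ Fintype.card F = x) : ∃ a : F, algebraMap F K a = x := by
  classical
  by_contra! hne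
  have hq : 1 < Fintype.card F := Fintype.one_lt_card
  set p : Polynomial K := Polynomial.X ^ Fintype.card F - Polynomial.X with hp
  have hp0 : p ≠ 0 := FiniteField.X_pow_card_sub_X_ne_zero K hq
  have hsub : insert x (Finset.univ.image (algebraMap F K)) ⊆ p.roots.toFinset := by
    intro y hy
    rw [Multiset.mem_toFinset, Polynomial.mem_roots hp0, Polynomial.IsRoot.def, hp,
      Polynomial.eval_sub, Polynomial.eval_pow, Polynomial.eval_X, sub_eq_zero]
    rcases Finset.mem_insert.1 hy with rfl | hy
    · exact hx
    · obtain ⟨a, -, rfl⟩ := Finset.mem_image.1 hy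
      rw [← map_pow, FiniteField.pow_card]
  have hle := (Finset.card_le_card hsub).trans
    ((Multiset.toFinset_card_le _).trans (Polynomial.card_roots' p))
  rw [FiniteField.X_pow_card_sub_X_natDegree_eq K hq, Finset.card_insert_of_notMem (by simpa using hne),
    Finset.card_image_of_injective _ (algebraMap F K).injective, Finset.card_univ] at hle
  omega

/-- Columns of a Moore matrix with `F`-linearly independent generators are linearly independent. -/
theorem eq_zero_of_sum_mul_pow_card_pow_eq_zero {F K ι : Type*} [Field F] [Fintype F]
    [Field K] [Algebra F K] (T : Finset ι) (γ : ι → K)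
    (hγ : ∀ a : ι → F, ∑ i ∈ T, a i • γ i = 0 → ∀ i ∈ T, a i = 0) (x : ι → K)
    (h : ∀ t < T.card, ∑ i ∈ T, x i * γ i ^ Fintype.card F ^ t = 0) : ∀ i ∈ T, x i = 0 := by
  classical
  induction T using Finset.induction generalizing γ x with
  | empty => simp
  | insert j T hj ih =>
    have hγT : ∀ a : ι → F, ∑ i ∈ T, a i • γ i = 0 → ∀ i ∈ T, a i = 0 := by
      intro a ha i hi
      have := hγ (fun i => if i ∈ T then a i else 0) (by
        rw [Finset.sum_insert hj, if_neg hj, zero_smul, zero_add, ← ha]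
        exact Finset.sum_congr rfl fun i hi => by rw [if_pos hi]) i (Finset.mem_insert_of_mem hi)
      rwa [if_pos hi] at this
    rw [Finset.card_insert_of_notMem hj] at h
    have hj0 : x j = 0 := by
      by_contra hxj
      set q := Fintype.card F with hq
      set z : ι → K := fun i => x i / x j with hz
      have hzj : z j = 1 := div_self hxj
      have hzs : ∀ t < T.card + 1, ∑ i ∈ insert j T, z i * γ i ^ q ^ t = 0 := by
        intro t ht
        have := congrArg (· / x j) (h t ht)
        simp only [Finset.sum_div, zero_div] at this
        rw [← this]
        exact Finset.sum_congr rfl fun i _ => by rw [hz]; ring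
      -- Frobenius of equation `t`, subtracted from equation `t + 1`, removes the `j` term because
      -- `z j = 1`. What is left is a Moore system on `T` with generators `γ i ^ q`.
      have hfrob : ∀ i ∈ T, z i - z i ^ q = 0 := by
        refine ih (fun i => γ i ^ q) ?_ (fun i => z i - z i ^ q) ?_
        · intro a ha
          refine hγT a ?_
          have : FiniteField.frobeniusAlgHom F K (∑ i ∈ T, a i • γ i) = 0 := by
            rw [map_sum, ← ha]
            exact Finset.sum_congr rfl fun i _ => by rw [map_smul]; rfl
          exact (map_eq_zero _).1 this
        · intro t ht
          have h1 := hzs (t + 1) (by omega)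
          have h2 : FiniteField.frobeniusAlgHom F K
              (∑ i ∈ insert j T, z i * γ i ^ q ^ t) = 0 := by
            rw [hzs t (by omega), map_zero]
          rw [map_sum, Finset.sum_insert hj] at h2
          rw [Finset.sum_insert hj] at h1
          simp only [FiniteField.coe_frobeniusAlgHom, hzj, mul_pow, one_pow, ← pow_mul,
            ← hq] at h2 h1
          rw [← sub_eq_zero.2 (h1.trans h2.symm)]
          simp only [← pow_mul, ← pow_succ, ← pow_succ', sub_mul, Finset.sum_sub_distrib]
          ring
      -- The coefficients `z i` are fixed by Frobenius, hence lie in `F`; equation `t = 0` is then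
      -- an `F`-linear relation among the `γ i` with coefficient `1` at `j`.
      have hex : ∀ i, ∃ a : F, i ∈ insert j T → algebraMap F K a = z i := by
        intro i
        by_cases hi : i ∈ insert j T
        · obtain ⟨a, ha⟩ := FiniteField.exists_algebraMap_eq_of_pow_card_eq (F := F) (x := z i) (by
            rcases Finset.mem_insert.1 hi with rfl | hi
            · rw [hzj, one_pow]
            · exact (sub_eq_zero.1 (hfrob i hi)).symm)
          exact ⟨a, fun _ => ha⟩
        · exact ⟨0, fun h => absurd h hi⟩
      choose a ha using hex
      have haj := hγ a (by
        rw [← hzs 0 (by omega)]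
        exact Finset.sum_congr rfl fun i hi => by
          rw [Algebra.smul_def, ha i hi, pow_zero, pow_one]) j (Finset.mem_insert_self _ _)
      have := ha j (Finset.mem_insert_self _ _)
      rw [haj, map_zero, hzj] at this
      exact zero_ne_one this
    intro i hi
    rcases Finset.mem_insert.1 hi with rfl | hi
    · exact hj0
    · refine ih γ hγT x (fun t ht => ?_) i hi
      have := h t (by omega)
      rwa [Finset.sum_insert hj, hj0, zero_mul, zero_add] at this

end Moore

/-! ### Array codes given by one parity-check matrix per row. -/

section RowCode

variable {K m ι κ : Type*} [Field K] {ℓ : ℕ} [Fintype ι]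

/-- The linear map applying to row `a` of an array the parity-check matrix `A a`. -/
def rowSyndrome (A : Fin ℓ → Matrix m ι K) : Matrix (Fin ℓ) ι K →ₗ[K] (Fin ℓ → m → K) where
  toFun c a := A a *ᵥ c a
  map_add' x y := funext fun a => Matrix.mulVec_add (A a) (x a) (y a)
  map_smul' u x := funext fun a => Matrix.mulVec_smul (A a) u (x a)

/-- The array code whose `a`-th rows are the kernel of `A a`. -/
def rowCode (A : Fin ℓ → Matrix m ι K) : Submodule K (Matrix (Fin ℓ) ι K) :=
  LinearMap.ker (rowSyndrome A)

theorem mem_rowCode {A : Fin ℓ → Matrix m ι K} {c : Matrix (Fin ℓ) ι K} :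
    c ∈ rowCode A ↔ ∀ a, A a *ᵥ c a = 0 := by
  rw [rowCode, LinearMap.mem_ker, funext_iff]
  rfl

theorem finrank_rowCode [Fintype m] {A : Fin ℓ → Matrix m ι K}
    (hA : ∀ a y, ∃ c, A a *ᵥ c = y) {k : ℕ} (hk : Fintype.card ι = Fintype.card m + k) :
    Module.finrank K (rowCode A) = ℓ * k := by
  have hsurj : Function.Surjective (rowSyndrome A) := by
    intro y
    choose c hc using fun a => hA a (y a)
    exact ⟨c, funext hc⟩
  have h := LinearMap.finrank_range_add_finrank_ker (rowSyndrome A)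
  rw [LinearMap.range_eq_top.2 hsurj, finrank_top, Module.finrank_matrix, hk] at h
  simp only [Module.finrank_pi_fintype, Module.finrank_self, Finset.sum_const, Finset.card_univ,
    Fintype.card_fin, smul_eq_mul, mul_one] at h
  change _ + Module.finrank K (rowCode A) = _ at h
  linarith

theorem columnWeight_le_iff [Finite κ] (c : Matrix (Fin ℓ) κ K) (w : ℕ) :
    columnWeight c ≤ w ↔ ∃ T : Finset κ, T.card ≤ w ∧ ∀ j ∉ T, ∀ a, c a j = 0 := by
  classical
  constructor
  · intro h
    have hfin := Set.toFinite {j : κ | ∃ a, c a j ≠ 0}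
    refine ⟨hfin.toFinset, by rwa [← Set.ncard_eq_toFinset_card _ hfin], fun j hj a => ?_⟩
    by_contra hne
    exact hj (hfin.mem_toFinset.2 ⟨a, hne⟩)
  · rintro ⟨T, hT, h⟩
    refine le_trans ?_ hT
    rw [← Set.ncard_coe_finset]
    refine Set.ncard_le_ncard ?_ T.finite_toSet
    rintro j ⟨a, ha⟩
    by_contra hj
    exact ha (h j hj a)

/-- If the kernels of all the matrices `A a` meet trivially the vectors which have at most `s` nonzero
entries on the range of `f`, then puncturing outside the range of `f` gives an MDS array code. -/
theorem isMDSArrayCode_map_rowCode [Fintype m] [Fintype κ] {A : Fin ℓ → Matrix m ι K} {f : κ → ι}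
    (hf : Function.Injective f) {k s : ℕ} (hℓ : 0 < ℓ) (hk : 0 < k)
    (hι : Fintype.card ι = Fintype.card m + k) (hκ : Fintype.card κ = k + s)
    (h : ∀ a c, A a *ᵥ c = 0 → ∀ T : Finset κ, T.card ≤ s → (∀ j ∉ T, c (f j) = 0) → c = 0) :
    (∀ a y, ∃ c, A a *ᵥ c = y) ∧
      IsMDSArrayCode ((rowCode A).map (columnMap K ℓ f)) (k + s) k (s + 1) := by
  classical
  have hle := Fintype.card_le_of_injective f hf
  -- `S` consists of the punctured positions and `T`. Its size is the number of parity checks plus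
  -- `|T| - s`: a square system for `|T| = s`, a nontrivial kernel for `|T| = s + 1`.
  have key : ∀ T : Finset κ, ∃ S : Finset ι, S.card = Fintype.card ι - Fintype.card κ + T.card ∧
      ∀ j, f j ∈ S → j ∈ T := by
    intro T
    refine ⟨(Finset.univ.image f)ᶜ ∪ T.image f, ?_, ?_⟩
    · rw [Finset.card_union_of_disjoint, Finset.card_compl, Finset.card_image_of_injective _ hf,
        Finset.card_image_of_injective _ hf, Finset.card_univ]
      rw [Finset.disjoint_left]
      intro x hx hx'
      obtain ⟨j, -, rfl⟩ := Finset.mem_image.1 hx'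
      simp at hx
    · intro j hj
      simpa [hf.eq_iff] using hj
  have hsurj : ∀ a y, ∃ c, A a *ᵥ c = y := by
    intro a y
    obtain ⟨T, -, hT⟩ := Finset.exists_subset_card_eq (s := (Finset.univ : Finset κ)) (n := s)
      (by rw [Finset.card_univ]; omega)
    obtain ⟨S, hS, hST⟩ := key T
    obtain ⟨c, -, hc⟩ := exists_supported_mulVec_eq (A := A a) (S := S) (by omega)
      (fun c hcS hc => h a c hc T hT.le fun j hj => hcS _ fun hjS => hj (hST j hjS)) y
    exact ⟨c, hc⟩
  have hlow : ∀ c ∈ rowCode A, columnWeight (columnMap K ℓ f c) ≤ s → c = 0 := by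
    intro c hc hw
    obtain ⟨T, hT, hcT⟩ := (columnWeight_le_iff _ _).1 hw
    funext a
    exact h a (c a) (mem_rowCode.1 hc a) T hT fun j hj => hcT j hj a
  have hker : Function.Injective ((columnMap K ℓ f).domRestrict (rowCode A)) := by
    rw [injective_iff_map_eq_zero]
    rintro ⟨c, hc⟩ h0
    refine Subtype.ext (hlow c hc ?_)
    change columnMap K ℓ f c = 0 at h0
    rw [h0, columnWeight_le_iff]
    exact ⟨∅, by simp, fun _ _ _ => rfl⟩
  refine ⟨hsurj, ⟨hκ, ?_, ?_, ?_⟩, by omega⟩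
  · rw [← LinearMap.range_domRestrict, LinearMap.finrank_range_of_inj hker, finrank_rowCode hsurj hι]
  · obtain ⟨T, -, hT⟩ := Finset.exists_subset_card_eq (s := (Finset.univ : Finset κ)) (n := s + 1)
      (by rw [Finset.card_univ]; omega)
    obtain ⟨S, hS, hST⟩ := key T
    obtain ⟨v, hvS, hv, hv0⟩ := exists_supported_mulVec_eq_zero (A ⟨0, hℓ⟩) (S := S) (by omega)
    -- The rows are independent, so a minimum-weight word needs only one nonzero row.
    set c : Matrix (Fin ℓ) ι K := fun a => if a = ⟨0, hℓ⟩ then v else 0 with hcdef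
    have hc : c ∈ rowCode A := by
      rw [mem_rowCode]
      intro a
      by_cases ha : a = ⟨0, hℓ⟩
      · rw [hcdef]
        simp only [if_pos ha]
        rw [ha, hv]
      · rw [hcdef]
        simp only [if_neg ha]
        exact Matrix.mulVec_zero _
    have hc0 : c ≠ 0 := by
      intro h0
      apply hv0
      have := congrFun h0 ⟨0, hℓ⟩
      rwa [hcdef] at this
    refine ⟨columnMap K ℓ f c, Submodule.mem_map_of_mem hc, ?_, le_antisymm ?_ ?_⟩
    · intro h0
      exact hc0 (congrArg Subtype.val (hker (a₁ := ⟨c, hc⟩) (a₂ := 0) (by rw [map_zero]; exact h0)))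
    · by_contra! hlt
      exact hc0 (hlow c hc (by omega))
    · rw [columnWeight_le_iff]
      refine ⟨T, hT.le, fun j hj a => ?_⟩
      change (if a = ⟨0, hℓ⟩ then v else 0) (f j) = 0
      split_ifs
      · exact hvS _ fun hjS => hj (hST j hjS)
      · rfl
  · rintro w ⟨_, ⟨c, hc, rfl⟩, hne, rfl⟩
    by_contra! hlt
    rw [hlow c hc (by omega), map_zero] at hne
    exact hne rfl

end RowCode

/-- Iterated Frobenius is `F`-linear. -/
theorem sum_smul_pow_card_pow {F K ι : Type*} [Field F] [Fintype F] [Field K] [Algebra F K]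
    (S : Finset ι) (a : ι → F) (x : ι → K) (t : ℕ) :
    (∑ i ∈ S, a i • x i) ^ Fintype.card F ^ t = ∑ i ∈ S, a i • x i ^ Fintype.card F ^ t := by
  induction t with
  | zero => simp
  | succ t ih =>
    have h := map_sum (FiniteField.frobeniusAlgHom F K) (fun i => a i • x i ^ Fintype.card F ^ t) S
    simp only [map_smul, FiniteField.coe_frobeniusAlgHom, ← pow_mul, ← pow_succ] at h
    conv_lhs => rw [pow_succ, pow_mul, ih, h]

/-- A Vandermonde kernel vector with prescribed support `insert k E`, where `E` has as many elements
as there are rows. -/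
theorem exists_vandermonde_kernel_vector {F ι : Type*} [Field F] [Fintype ι] [DecidableEq ι]
    {x : ι → F} (hx : Function.Injective x) {r : ℕ} {E : Finset ι} (hE : E.card = r) {k : ι}
    (hk : k ∉ E) : ∃ v : ι → F, v k = 1 ∧ (∀ j ∉ insert k E, v j = 0) ∧
      ∀ t < r, ∑ j, x j ^ t * v j = 0 := by
  -- Solve the square Vandermonde system on `E` for minus column `k`; adding `1` at `k` gives the
  -- kernel vector.
  obtain ⟨c, hcE, hc⟩ := exists_supported_mulVec_eq
    (A := Matrix.of fun (t : Fin r) j => x j ^ (t : ℕ)) (S := E) (by simpa using hE)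
    (fun c hcE hc => by
      ext j
      by_cases hj : j ∈ E
      · refine eq_zero_of_sum_pow_mul_eq_zero hx.injOn hE.le (fun t ht => ?_) j hj
        refine Eq.trans ?_ (congrFun hc ⟨t, ht⟩)
        exact Finset.sum_subset (Finset.subset_univ _) fun i _ hi => by rw [hcE i hi, mul_zero]
      · exact hcE j hj) (fun t => -x k ^ (t : ℕ))
  refine ⟨c + Pi.single k 1, by simp [hcE k hk], fun j hj => ?_, fun t ht => ?_⟩
  · rw [Finset.mem_insert, not_or] at hj
    simp [hcE j hj.2, hj.1]
  · have := congrFun hc ⟨t, ht⟩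
    simp only [Matrix.mulVec, dotProduct, Matrix.of_apply] at this
    simp only [Pi.add_apply, mul_add, Finset.sum_add_distrib, this, Pi.single_apply, mul_ite,
      mul_one, mul_zero, Finset.sum_ite_eq', Finset.mem_univ, if_true, neg_add_cancel]

/-! ### Independence of columns of `H^(a)`. -/

section PMDS

variable {F K : Type*} [Field F] [Field K] {μ n b : ℕ} [Algebra F K]

/-- The `n` nodes used in row `a`. -/
def digitNode {X : Type*} (β : Fin n → Fin b → X) (a : Fin (b ^ n)) (k : Fin n) : X :=
  β k (finFunctionFinEquiv.symm a k)

theorem digitNode_injective {X : Type*} {β : Fin n → Fin b → X}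
    (hβ : Function.Injective fun p : Fin n × Fin b => β p.1 p.2) (a : Fin (b ^ n)) :
    Function.Injective (digitNode β a) := by
  intro k l h
  exact congrArg Prod.fst (@hβ (k, _) (l, _) h)

theorem pmdsParity_mulVec_inl (q r s : ℕ) (β : Fin n → Fin b → F) (α : Fin μ → Fin n → K)
    (a : Fin (b ^ n)) (c : Fin μ × Fin n → K) (i : Fin μ) (t : Fin r) :
    (pmdsParity q r s β α a *ᵥ c) (Sum.inl (i, t)) =
      ∑ k, algebraMap F K (digitNode β a k) ^ (t : ℕ) * c (i, k) := by
  simp only [Matrix.mulVec, dotProduct, Fintype.sum_prod_type, pmdsParity, Matrix.of_apply]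
  rw [Finset.sum_eq_single i]
  · simp [yeBargParity, digitNode]
  · intro j _ hj
    simp [hj.symm]
  · simp

theorem pmdsParity_mulVec_inr (q r s : ℕ) (β : Fin n → Fin b → F) (α : Fin μ → Fin n → K)
    (a : Fin (b ^ n)) (c : Fin μ × Fin n → K) (t : Fin s) :
    (pmdsParity q r s β α a *ᵥ c) (Sum.inr t) = ∑ p, α p.1 p.2 ^ q ^ (t : ℕ) * c p := rfl

/-- Combinations of at most `s` of the `α`, each perturbed by `r` further ones inside an erased set,
are linearly independent. -/
theorem eq_zero_of_sum_smul_eq_zero {ι : Type*} [Fintype ι] [DecidableEq ι] {r s : ℕ} {α : ι → K}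
    (hα : ∀ T : Finset ι, T.card ≤ (r + 1) * s → LinearIndependent F fun p : T => α p)
    {B : ι → Finset ι} (hB : ∀ τ, (B τ).card ≤ r) {V : ι → ι → F} {T : Finset ι} (hT : T.card ≤ s)
    (hV : ∀ τ ∈ T, ∀ p, p ∉ insert τ (B τ) → V τ p = 0)
    (hV1 : ∀ τ ∈ T, ∀ τ' ∈ T, V τ τ' = if τ = τ' then 1 else 0) (a : ι → F)
    (h : ∑ τ ∈ T, a τ • ∑ p, V τ p • α p = 0) : ∀ τ ∈ T, a τ = 0 := by
  set U : Finset ι := T.biUnion fun τ => insert τ (B τ) with hU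
  -- Each `τ` contributes itself and at most `r` positions of `B τ`, whence the bound `(r + 1) s`.
  have hUcard : U.card ≤ (r + 1) * s := by
    calc U.card ≤ T.card * (r + 1) := Finset.card_biUnion_le_card_mul _ _ _ fun τ _ =>
          (Finset.card_insert_le _ _).trans (Nat.add_le_add_right (hB τ) 1)
      _ ≤ (r + 1) * s := by rw [mul_comm]; exact Nat.mul_le_mul_left _ hT
  set w : ι → F := fun p => ∑ τ ∈ T, a τ * V τ p with hw
  have hwU : ∀ p ∉ U, w p = 0 := by
    intro p hp
    refine Finset.sum_eq_zero fun τ hτ => ?_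
    rw [hV τ hτ p fun hmem => hp (Finset.mem_biUnion.2 ⟨τ, hτ, hmem⟩), mul_zero]
  have hsum : ∑ p ∈ U, w p • α p = 0 := by
    rw [Finset.sum_subset (Finset.subset_univ U) fun p _ hp => by rw [hwU p hp, zero_smul], ← h]
    simp only [hw, Finset.sum_smul, Finset.smul_sum, mul_smul]
    exact Finset.sum_comm
  intro τ hτ
  have hτU : τ ∈ U := Finset.mem_biUnion.2 ⟨τ, hτ, Finset.mem_insert_self _ _⟩
  have h0 := Fintype.linearIndependent_iff.1 (hα U hUcard) (fun p => w p)
    (by rw [← hsum]; exact Finset.sum_coe_sort U fun p => w p • α p) ⟨τ, hτU⟩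
  change ∑ τ' ∈ T, a τ' * V τ' τ = 0 at h0
  rw [Finset.sum_eq_single_of_mem τ hτ fun τ' hτ' hne => by
    rw [hV1 τ' hτ' τ hτ, if_neg hne, mul_zero], hV1 τ hτ τ hτ, if_pos rfl, mul_one] at h0
  exact h0

/-- Any `r` columns of every local group together with any `s` further columns of `H^(a)` are linearly
independent. -/
theorem eq_zero_of_pmdsParity_mulVec_eq_zero [Fintype F] {r s : ℕ} {β : Fin n → Fin b → F}
    (hβ : Function.Injective fun p : Fin n × Fin b => β p.1 p.2) {α : Fin μ → Fin n → K}
    (hα : ∀ T : Finset (Fin μ × Fin n), T.card ≤ (r + 1) * s →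
      LinearIndependent F fun p : T => α p.1.1 p.1.2)
    (a : Fin (b ^ n)) {E : Fin μ → Finset (Fin n)} (hE : ∀ i, (E i).card = r)
    {T : Finset (Fin μ × Fin n)} (hT : T.card ≤ s) (hTE : ∀ p ∈ T, p.2 ∉ E p.1)
    {c : Fin μ × Fin n → K} (hc : pmdsParity (Fintype.card F) r s β α a *ᵥ c = 0)
    (hsupp : ∀ p, p.2 ∉ E p.1 → p ∉ T → c p = 0) : c = 0 := by
  classical
  have hx := digitNode_injective hβ a
  set x := digitNode β a with hxdef
  have hex : ∀ τ : Fin μ × Fin n, ∃ v : Fin n → F, τ.2 ∉ E τ.1 → v τ.2 = 1 ∧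
      (∀ j ∉ insert τ.2 (E τ.1), v j = 0) ∧ ∀ t < r, ∑ j, x j ^ t * v j = 0 := by
    intro τ
    by_cases hτ : τ.2 ∈ E τ.1
    · exact ⟨0, fun h => absurd hτ h⟩
    · obtain ⟨v, hv⟩ := exists_vandermonde_kernel_vector hx (hE τ.1) hτ
      exact ⟨v, fun _ => hv⟩
  choose v hv using hex
  set V : Fin μ × Fin n → Fin μ × Fin n → F := fun τ p => if τ.1 = p.1 then v τ p.2 else 0 with hVdef
  have hV1 : ∀ τ ∈ T, ∀ p, p.2 ∉ E p.1 → V τ p = if τ = p then 1 else 0 := by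
    rintro ⟨i, k⟩ hτ ⟨j, l⟩ hp
    by_cases hij : i = j
    · subst hij
      by_cases hkl : k = l
      · subst hkl
        simpa [hVdef] using (hv (i, k) hp).1
      · have := (hv (i, k) (hTE _ hτ)).2.1 l
          (by simpa [Finset.mem_insert, Ne.symm hkl] using hp)
        simp [hVdef, this, hkl]
    · simp [hVdef, hij]
  have hV0 : ∀ τ ∈ T, ∀ i, ∀ t < r, ∑ k, x k ^ t * V τ (i, k) = 0 := by
    intro τ hτ i t ht
    by_cases hi : τ.1 = i
    · simp only [hVdef, if_pos hi]
      exact (hv τ (hTE τ hτ)).2.2 t ht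
    · simp [hVdef, hi]
  -- Both sides agree off the sets `E i` and satisfy the local equations, so their difference is a
  -- Vandermonde kernel vector on at most `r` nodes.
  have hcV : ∀ p, c p = ∑ τ ∈ T, algebraMap F K (V τ p) * c τ := by
    have hout : ∀ p : Fin μ × Fin n, p.2 ∉ E p.1 → c p = ∑ τ ∈ T, algebraMap F K (V τ p) * c τ := by
      intro p hp
      rw [Finset.sum_congr rfl fun τ hτ => by rw [hV1 τ hτ p hp]]
      by_cases hpT : p ∈ T
      · rw [Finset.sum_eq_single_of_mem p hpT fun τ _ hne => by rw [if_neg hne, map_zero, zero_mul],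
          if_pos rfl, map_one, one_mul]
      · rw [hsupp p hp hpT]
        refine (Finset.sum_eq_zero fun τ hτ => ?_).symm
        rw [if_neg (by rintro rfl; exact hpT hτ), map_zero, zero_mul]
    rintro ⟨i, k⟩
    by_cases hk : k ∈ E i
    · refine sub_eq_zero.1 (eq_zero_of_sum_pow_mul_eq_zero (S := E i) (r := r)
        (x := fun k => algebraMap F K (x k))
        (c := fun k => c (i, k) - ∑ τ ∈ T, algebraMap F K (V τ (i, k)) * c τ)
        ((algebraMap F K).injective.comp hx).injOn (hE i).le (fun t ht => ?_) k hk)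
      rw [Finset.sum_subset (Finset.subset_univ _) fun l _ hl => by
        rw [sub_eq_zero.2 (hout (i, l) hl), mul_zero]]
      have h1 := congrFun hc (Sum.inl (i, ⟨t, ht⟩))
      rw [pmdsParity_mulVec_inl] at h1
      change ∑ k, algebraMap F K (x k) ^ t * c (i, k) = 0 at h1
      simp only [mul_sub, Finset.sum_sub_distrib, h1, zero_sub, neg_eq_zero, Finset.mul_sum]
      rw [Finset.sum_comm]
      refine Finset.sum_eq_zero fun τ hτ => ?_
      have h2 := congrArg (algebraMap F K) (hV0 τ hτ i t ht)
      simp only [map_sum, map_mul, map_pow, map_zero] at h2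
      rw [← zero_mul (c τ), ← h2, Finset.sum_mul]
      exact Finset.sum_congr rfl fun _ _ => by ring
    · exact hout _ hk
  -- Substituting `hcV` into the last `s` rows leaves a Moore system for the values of `c` on `T`.
  have hcT := eq_zero_of_sum_mul_pow_card_pow_eq_zero (F := F) T
    (fun τ => ∑ p, V τ p • α p.1 p.2)
    (eq_zero_of_sum_smul_eq_zero (α := fun p : Fin μ × Fin n => α p.1 p.2) hα
      (B := fun τ => (E τ.1).image fun k => (τ.1, k))
      (fun τ => Finset.card_image_le.trans (hE τ.1).le) hT
      (fun τ hτ p hp => by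
        obtain ⟨i, k⟩ := τ
        obtain ⟨j, l⟩ := p
        by_cases hij : i = j
        · subst hij
          by_cases hl : l ∈ E i
          · exact absurd (by simp [hl]) hp
          · rw [hV1 _ hτ (i, l) hl, if_neg]
            rintro h
            exact hp (Finset.mem_insert.2 (Or.inl h.symm))
        · simp [hVdef, hij])
      (fun τ hτ τ' hτ' => hV1 τ hτ τ' (hTE τ' hτ'))) c (fun t ht => by
        have h1 := congrFun hc (Sum.inr ⟨t, by omega⟩)
        rw [pmdsParity_mulVec_inr] at h1
        simp only [sum_smul_pow_card_pow, Finset.mul_sum]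
        rw [Finset.sum_comm]
        refine Eq.trans ?_ h1
        refine Finset.sum_congr rfl fun p _ => ?_
        rw [hcV p, Finset.mul_sum]
        exact Finset.sum_congr rfl fun τ _ => by rw [Algebra.smul_def]; ring)
  ext p
  rw [hcV p]
  exact Finset.sum_eq_zero fun τ hτ => by rw [hcT τ hτ, mul_zero]

end PMDS

/-! ### Averaging and the cut-set bound. -/

/-- If every `b` of the numbers `t i` add up to at least `ℓ`, then the average of all of them is at
least `ℓ / b`. -/
theorem card_mul_le_mul_sum {ι : Type*} [Fintype ι] {b ℓ : ℕ} (hb : b ≤ Fintype.card ι) (t : ι → ℕ)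
    (h : ∀ S : Finset ι, S.card = b → ℓ ≤ ∑ i ∈ S, t i) :
    Fintype.card ι * ℓ ≤ b * ∑ i, t i := by
  classical
  rcases Nat.eq_zero_or_pos (Fintype.card ι) with h0 | h0
  · simp [h0]
  have : NeZero (Fintype.card ι) := ⟨h0.ne'⟩
  set e := Fintype.equivFin ι
  have hinj : ∀ x : Fin (Fintype.card ι), Function.Injective fun j : Fin b =>
      e.symm (x + Fin.castLE hb j) := fun x i j hij =>
    Fin.castLE_injective hb (add_left_cancel (e.symm.injective hij))
  -- Apply the hypothesis to cyclic windows of length `b`; over all starting points `x`, each index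
  -- is covered exactly `b` times.
  have h1 : ∀ x : Fin (Fintype.card ι), ℓ ≤ ∑ j : Fin b, t (e.symm (x + Fin.castLE hb j)) := by
    intro x
    refine (h (Finset.univ.image fun j : Fin b => e.symm (x + Fin.castLE hb j)) ?_).trans ?_
    · rw [Finset.card_image_of_injective _ (hinj x), Finset.card_univ, Fintype.card_fin]
    · rw [Finset.sum_image (hinj x).injOn]
  calc Fintype.card ι * ℓ = ∑ _x : Fin (Fintype.card ι), ℓ := by simp
    _ ≤ ∑ x, ∑ j : Fin b, t (e.symm (x + Fin.castLE hb j)) := Finset.sum_le_sum fun x _ => h1 x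
    _ = ∑ j : Fin b, ∑ x, t (e.symm (x + Fin.castLE hb j)) := Finset.sum_comm
    _ = ∑ _j : Fin b, ∑ i, t i := Finset.sum_congr rfl fun j _ =>
        ((Equiv.addRight (Fin.castLE hb j)).trans e.symm).sum_comp t
    _ = b * ∑ i, t i := by simp

section Repair

variable {K κ : Type*} [Field K] {ℓ : ℕ}

/-- The cut-set bound. If the column `j` of the codewords vanishing on all but `b` of the helper
columns `R` is arbitrary, then at least `|R| ℓ / b` symbols must be downloaded from `R` to repair it. -/
theorem card_mul_le_of_canRepair [Finite K] {C : Submodule K (Matrix (Fin ℓ) κ K)} {j : κ}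
    {R : Finset κ} {b m : ℕ} (hb : b ≤ R.card)
    (hC : ∀ Z ⊆ R, Z.card + b = R.card → ∀ v : Fin ℓ → K,
      ∃ c ∈ C, (∀ i ∈ Z, ∀ a, c a i = 0) ∧ ∀ a, c a j = v a)
    (h : CanRepair C {j} R m) : R.card * ℓ ≤ b * m := by
  classical
  have := Fintype.ofFinite K
  obtain ⟨t, f, g, rfl, hg⟩ := h
  rw [← Fintype.card_coe R]
  refine card_mul_le_mul_sum (by rwa [Fintype.card_coe]) t fun S hS => ?_
  have hZ : ((Sᶜ : Finset R).map (Function.Embedding.subtype _)).card + b = R.card := by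
    rw [Finset.card_map, Finset.card_compl, Fintype.card_coe]
    have := Finset.card_le_univ S
    rw [Fintype.card_coe] at this
    omega
  choose c hcC hcZ hcj using hC _ (fun x hx => by
    obtain ⟨y, -, rfl⟩ := Finset.mem_map.1 hx
    exact y.2) hZ
  -- Helpers outside `S` see a zero column and always send the same message, so the messages from
  -- `S` alone determine `v`. Counting gives `|K| ^ ℓ ≤ |K| ^ ∑ t`, even for nonlinear repair.
  have hinj : Function.Injective fun (v : Fin ℓ → K) (i : S) => f i.1 fun a => c v a i.1 := by
    intro v v' hvv
    have hdata : (fun i : R => f i fun a => c v a i) = fun i : R => f i fun a => c v' a i := by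
      funext i
      by_cases hi : i ∈ S
      · exact congrFun hvv ⟨i, hi⟩
      · have hi' : (i : κ) ∈ (Sᶜ : Finset R).map (Function.Embedding.subtype _) :=
          Finset.mem_map.2 ⟨i, Finset.mem_compl.2 hi, rfl⟩
        have hcol : (fun a => c v a i) = fun a => c v' a i :=
          funext fun a => by rw [hcZ v i hi' a, hcZ v' i hi' a]
        rw [hcol]
    have h1 := hg (c v) (hcC v) ⟨j, Finset.mem_singleton_self j⟩
    have h2 := hg (c v') (hcC v') ⟨j, Finset.mem_singleton_self j⟩
    rw [hdata, h2] at h1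
    funext a
    rw [← hcj v a, ← hcj v' a]
    exact (congrFun h1 a).symm
  have hcard := Fintype.card_le_of_injective _ hinj
  simp only [Fintype.card_pi, Finset.prod_const, Finset.card_univ, Fintype.card_fin] at hcard
  rw [Finset.prod_pow_eq_pow_sum, Nat.pow_le_pow_iff_right Fintype.one_lt_card] at hcard
  rwa [← Finset.sum_coe_sort S]

/-- A linear map `S` applied by every helper column of `R` repairs column `j` as soon as a codeword
for which all helpers send `0` vanishes in column `j`. -/
theorem canRepair_of_linearMap {C : Submodule K (Matrix (Fin ℓ) κ K)} {j : κ} {R : Finset κ}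
    {X : Type*} [Fintype X] (S : (Fin ℓ → K) →ₗ[K] (X → K))
    (h : ∀ c ∈ C, (∀ i ∈ R, S (fun a => c a i) = 0) → ∀ a, c a j = 0) :
    CanRepair C {j} R (R.card * Fintype.card X) := by
  classical
  let e := Fintype.equivFin X
  let f : ∀ _ : R, (Fin ℓ → K) → (Fin (Fintype.card X) → K) := fun _ v y => S v (e.symm y)
  let data : C → ∀ _ : R, Fin (Fintype.card X) → K := fun c i => f i fun a => c.1 a i
  refine ⟨fun _ => Fintype.card X, f,
    -- The value `0` on data that no codeword produces is irrelevant.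
    fun D i a => Function.extend data (fun c a => c.1 a j) 0 D a, by simp, ?_⟩
  rintro c hc ⟨i, hi⟩
  obtain rfl := Finset.mem_singleton.1 hi
  have hfac : Function.FactorsThrough (fun (c : C) a => c.1 a i) data := by
    intro c c' hcc
    funext a
    refine sub_eq_zero.1 (h (c.1 - c'.1) (C.sub_mem c.2 c'.2) (fun k hk => ?_) a)
    have : (fun a => (c.1 - c'.1) a k) = (fun a => c.1 a k) - fun a => c'.1 a k := rfl
    rw [this, map_sub, sub_eq_zero]
    funext x
    have := congrFun (congrFun hcc ⟨k, hk⟩) (e x)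
    simpa [data, f] using this
  funext a
  exact congrFun (hfac.extend_apply 0 ⟨c, hc⟩) a

end Repair

/-! ### Ye–Barg codes and their repair bandwidth. -/

section YeBarg

variable {K κ : Type*} [Field K] {n b : ℕ}

theorem mem_yeBargCode {r : ℕ} {γ : Fin n → Fin b → K} {c : Matrix (Fin (b ^ n)) (Fin n) K} :
    c ∈ yeBargCode r γ ↔ ∀ a, yeBargParity r γ a *ᵥ c a = 0 := Iff.rfl

theorem yeBargCode_eq_rowCode (r : ℕ) (γ : Fin n → Fin b → K) :
    yeBargCode r γ = rowCode (yeBargParity r γ) :=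
  Submodule.ext fun _ => mem_yeBargCode.trans mem_rowCode.symm

theorem isMDSArrayCode_map_yeBargCode [Fintype κ] {r : ℕ} {γ : Fin n → Fin b → K}
    (hγ : Function.Injective fun p : Fin n × Fin b => γ p.1 p.2) (hb : 0 < b) (hrn : r < n)
    {f : κ → Fin n} (hf : Function.Bijective f) :
    IsMDSArrayCode ((yeBargCode r γ).map (columnMap K (b ^ n) f)) n (n - r) (r + 1) := by
  classical
  have h := (isMDSArrayCode_map_rowCode (A := yeBargParity r γ) hf.1 (k := n - r) (s := r)
    (pow_pos hb n) (by omega) (by simp; omega)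
    (by rw [Fintype.card_of_bijective hf, Fintype.card_fin]; omega) ?_).2
  · rwa [← yeBargCode_eq_rowCode, Nat.sub_add_cancel hrn.le] at h
  · intro a c hc T hT hcT
    have hout : ∀ k ∉ T.image f, c k = 0 := by
      intro k hk
      obtain ⟨j, rfl⟩ := hf.2 k
      exact hcT j fun hj => hk (Finset.mem_image_of_mem f hj)
    ext k
    by_cases hk : k ∈ T.image f
    · refine eq_zero_of_sum_pow_mul_eq_zero (digitNode_injective hγ a).injOn
        (Finset.card_image_le.trans hT) (fun t ht => ?_) k hk
      refine Eq.trans ?_ (congrFun hc ⟨t, ht⟩)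
      exact Finset.sum_subset (Finset.subset_univ _) fun i _ hi => by rw [hout i hi, mul_zero]
    · exact hout k hk

/-- Any column together with any `n - r - 1` further columns can be prescribed. -/
theorem exists_mem_yeBargCode {r : ℕ} {γ : Fin n → Fin b → K}
    (hγ : Function.Injective fun p : Fin n × Fin b => γ p.1 p.2) {j : Fin n} {Z : Finset (Fin n)}
    (hj : j ∉ Z) (hZ : Z.card + r + 1 = n) (v : Fin (b ^ n) → K) :
    ∃ c ∈ yeBargCode r γ, (∀ i ∈ Z, ∀ a, c a i = 0) ∧ ∀ a, c a j = v a := by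
  have hE : ((insert j Z)ᶜ).card = r := by
    rw [Finset.card_compl, Finset.card_insert_of_notMem hj, Fintype.card_fin]
    omega
  choose w hwj hw0 hw using fun a => exists_vandermonde_kernel_vector
    (digitNode_injective hγ a) hE (k := j) (by simp)
  refine ⟨fun a => v a • w a, mem_yeBargCode.2 fun a => ?_, fun i hi a => ?_, fun a => ?_⟩
  · rw [Matrix.mulVec_smul]
    have : yeBargParity r γ a *ᵥ w a = 0 := funext fun t => hw a t t.2
    rw [this, smul_zero]
  · have : i ≠ j := fun h => hj (h ▸ hi)
    simp [hw0 a i (by simp [hi, this])]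
  · simp [hwj a]

/-- The row number with digit `u` at position `j` and the digits `g` elsewhere. -/
def rowOfDigits (j : Fin n) (g : {k // k ≠ j} → Fin b) (u : Fin b) : Fin (b ^ n) :=
  finFunctionFinEquiv fun k => if h : k = j then u else g ⟨k, h⟩

theorem digitNode_rowOfDigits_self {X : Type*} (γ : Fin n → Fin b → X) (j : Fin n)
    (g : {k // k ≠ j} → Fin b) (u : Fin b) : digitNode γ (rowOfDigits j g u) j = γ j u := by
  simp [digitNode, rowOfDigits]

theorem digitNode_rowOfDigits_of_ne {X : Type*} (γ : Fin n → Fin b → X) {j k : Fin n} (hk : k ≠ j)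
    (g : {k // k ≠ j} → Fin b) (u : Fin b) :
    digitNode γ (rowOfDigits j g u) k = γ k (g ⟨k, hk⟩) := by
  simp [digitNode, rowOfDigits, hk]

/-- The linear map adding up the entries in rows which differ in the digit `j` only. -/
def digitSum (K : Type*) [Field K] (b : ℕ) (j : Fin n) :
    (Fin (b ^ n) → K) →ₗ[K] (({k // k ≠ j} → Fin b) → K) where
  toFun v g := ∑ u, v (rowOfDigits j g u)
  map_add' x y := funext fun g => by simp [Finset.sum_add_distrib]
  map_smul' a x := funext fun g => by simp [Finset.mul_sum]

/-- The Ye--Barg repair scheme: the digit sums of the columns in `R` determine column `j`. -/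
theorem eq_zero_of_digitSum_eq_zero {r : ℕ} {γ : Fin n → Fin b → K}
    (hγ : Function.Injective fun p : Fin n × Fin b => γ p.1 p.2) {j : Fin n} {R : Finset (Fin n)}
    (hj : j ∉ R) (hR : n + b ≤ R.card + 1 + r) {c : Matrix (Fin (b ^ n)) (Fin n) K}
    (hc : c ∈ yeBargCode r γ) (hcR : ∀ i ∈ R, digitSum K b j (fun a => c a i) = 0)
    (a : Fin (b ^ n)) : c a j = 0 := by
  set δ := finFunctionFinEquiv.symm a with hδ
  set g : {k // k ≠ j} → Fin b := fun k => δ k with hg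
  have ha : rowOfDigits j g (δ j) = a := by
    have : (fun k => if h : k = j then δ j else g ⟨k, h⟩) = δ := by
      funext k
      split_ifs with h
      · rw [h]
      · rfl
    rw [rowOfDigits, this, hδ, Equiv.apply_symm_apply]
  set P : Finset (Fin n) := (insert j R)ᶜ with hP
  have hPj : ∀ i ∈ P, i ≠ j := by
    rintro i hi rfl
    simp [hP] at hi
  have hPcard : P.card + (R.card + 1) = n := by
    have := Finset.card_compl_add_card (insert j R)
    rwa [Finset.card_insert_of_notMem hj, Fintype.card_fin] at this
  -- The unknowns are the digit sums of the non-helper columns `P` and the `b` entries of column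
  -- `j`; `hR` says that `|P| + b ≤ r`. Distinctness of all the `γ` keeps the nodes of the two kinds
  -- apart.
  have key := eq_zero_of_sum_pow_mul_eq_zero (S := P.disjSum (Finset.univ : Finset (Fin b)))
    (x := Sum.elim (digitNode γ a) (γ j)) (r := r)
    (c := Sum.elim (fun i => ∑ u, c (rowOfDigits j g u) i) fun u => c (rowOfDigits j g u) j)
    ?_ ?_ ?_ (Sum.inr (δ j)) (by simp)
  · rw [← ha]
    exact key
  · rintro (i | u) hi (i' | u') hi' h
    · exact congrArg Sum.inl (digitNode_injective hγ a h)
    · exact absurd (congrArg Prod.fst (@hγ (i, δ i) (j, u') h)) (hPj i (by simpa using hi))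
    · exact absurd (congrArg Prod.fst (@hγ (j, u) (i', δ i') h)).symm (hPj i' (by simpa using hi'))
    · exact congrArg Sum.inr (congrArg Prod.snd (@hγ (j, u) (j, u') h))
  · rw [Finset.card_disjSum, Finset.card_univ, Fintype.card_fin]
    omega
  · intro t ht
    rw [Finset.sum_disjSum]
    simp only [Sum.elim_inl, Sum.elim_inr]
    have hrow : ∑ u, ∑ i, digitNode γ (rowOfDigits j g u) i ^ t * c (rowOfDigits j g u) i = 0 :=
      Finset.sum_eq_zero fun u _ => congrFun (mem_yeBargCode.1 hc (rowOfDigits j g u)) ⟨t, ht⟩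
    rw [Finset.sum_comm, ← Finset.sum_compl_add_sum (insert j R), Finset.sum_insert hj] at hrow
    have hne : ∀ i ≠ j, ∑ u, digitNode γ (rowOfDigits j g u) i ^ t * c (rowOfDigits j g u) i =
        digitNode γ a i ^ t * ∑ u, c (rowOfDigits j g u) i := by
      intro i hi
      rw [Finset.mul_sum]
      refine Finset.sum_congr rfl fun u _ => ?_
      rw [digitNode_rowOfDigits_of_ne γ hi]
      rfl
    have hR0 : ∑ i ∈ R, ∑ u, digitNode γ (rowOfDigits j g u) i ^ t *
        c (rowOfDigits j g u) i = 0 := by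
      refine Finset.sum_eq_zero fun i hi => ?_
      rw [hne i fun h => hj (h ▸ hi)]
      have := congrFun (hcR i hi) g
      change ∑ u, c (rowOfDigits j g u) i = 0 at this
      rw [this, mul_zero]
    rw [hR0, add_zero, Finset.sum_congr rfl fun i hi => hne i (hPj i hi)] at hrow
    rw [← hrow]
    simp only [digitNode_rowOfDigits_self]

/-- Digit sums attain the bound. For the converse, `d - b = n - r - 1` helper columns can be made
zero with column `j` still arbitrary, so the cut-set bound applies. -/
theorem repairBandwidth_map_yeBargCode [Finite K] {r d : ℕ} {γ : Fin n → Fin b → K}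
    (hγ : Function.Injective fun p : Fin n × Fin b => γ p.1 p.2) (hb : 0 < b)
    (hd : d + 1 + r = n + b) (hrn : r < n) {f : κ → Fin n} (hf : Function.Injective f) {j : κ}
    {R : Finset κ} (hR : R.card = d) (hj : j ∉ R) :
    repairBandwidth ((yeBargCode r γ).map (columnMap K (b ^ n) f)) {j} R = d * b ^ (n - 1) := by
  classical
  have hjR : ∀ Z ⊆ R, f j ∉ Z.image f := by
    intro Z hZ h
    obtain ⟨i, hi, hij⟩ := Finset.mem_image.1 h
    exact hj (hf hij ▸ hZ hi)
  have hup : CanRepair ((yeBargCode r γ).map (columnMap K (b ^ n) f)) {j} R (d * b ^ (n - 1)) := by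
    have h := canRepair_of_linearMap (C := (yeBargCode r γ).map (columnMap K (b ^ n) f)) (j := j)
      (R := R) (digitSum K b (f j)) ?_
    · simpa [hR, Fintype.card_subtype_compl] using h
    · rintro _ ⟨c, hc, rfl⟩ h
      refine eq_zero_of_digitSum_eq_zero hγ (hjR R subset_rfl) ?_ hc ?_
      · rw [Finset.card_image_of_injective _ hf]
        omega
      · intro k hk
        obtain ⟨i, hi, rfl⟩ := Finset.mem_image.1 hk
        exact h i hi
  refine le_antisymm (Nat.sInf_le hup) ?_
  -- `hup` makes the set of bandwidths nonempty, so its `sInf` is attained and is not the default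
  -- `0`.
  have hlow := card_mul_le_of_canRepair (b := b) (by omega) ?_
    (Nat.sInf_mem (s := {m | CanRepair ((yeBargCode r γ).map (columnMap K (b ^ n) f)) {j} R m})
      ⟨_, hup⟩)
  · refine Nat.le_of_mul_le_mul_left (le_trans (le_of_eq ?_) hlow) hb
    rw [hR]
    obtain ⟨n, rfl⟩ : ∃ k, n = k + 1 := ⟨n - 1, by omega⟩
    rw [Nat.add_sub_cancel]
    ring
  · intro Z hZ hZb v
    obtain ⟨c, hc, hcZ, hcj⟩ := exists_mem_yeBargCode (r := r) hγ (hjR Z hZ)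
      (by rw [Finset.card_image_of_injective _ hf]; omega) v
    exact ⟨_, Submodule.mem_map_of_mem hc,
      fun i hi a => hcZ (f i) (Finset.mem_image_of_mem f hi) a, hcj⟩

/-- The bandwidth is the same for every failed node and helper set, so the maximum is this common
value; `d < n` ensures that a helper set exists. -/
theorem isMSR_map_yeBargCode [Finite K] [Fintype κ] {r d : ℕ} {γ : Fin n → Fin b → K}
    (hγ : Function.Injective fun p : Fin n × Fin b => γ p.1 p.2) (hb : 0 < b)
    (hr : 0 < r) (hrn : r < n) (hdn : d < n) (hd : d + 1 + r = n + b)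
    {f : κ → Fin n} (hf : Function.Bijective f) :
    IsMSR ((yeBargCode r γ).map (columnMap K (b ^ n) f)) n r 1 d := by
  classical
  have hval : ((1 : ℕ) : ℚ) * d * ((b ^ n : ℕ) : ℚ) / (((1 : ℕ) : ℚ) + d - n + r) =
      ((d * b ^ (n - 1) : ℕ) : ℚ) := by
    have hden : ((1 : ℕ) : ℚ) + d - n + r = b := by
      have : ((d + 1 + r : ℕ) : ℚ) = ((n + b : ℕ) : ℚ) := by rw [hd]
      push_cast at this ⊢
      linarith
    have hb0 : (b : ℚ) ≠ 0 := by exact_mod_cast hb.ne'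
    obtain ⟨n, rfl⟩ : ∃ k, n = k + 1 := ⟨n - 1, by omega⟩
    rw [hden, div_eq_iff hb0, Nat.add_sub_cancel]
    push_cast
    ring
  refine ⟨hrn.le, le_rfl, hr, by omega, isMDSArrayCode_map_yeBargCode hγ hb hrn hf, ?_, ?_⟩
  · have hcard : Fintype.card κ = n := by rw [Fintype.card_of_bijective hf, Fintype.card_fin]
    have : Nonempty κ := Fintype.card_pos_iff.1 (by omega)
    let j : κ := Classical.arbitrary κ
    obtain ⟨R, hRj, hR⟩ := Finset.exists_subset_card_eq (s := ({j}ᶜ : Finset κ)) (n := d)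
      (by rw [Finset.card_compl, Finset.card_singleton]; omega)
    have hj : j ∉ R := fun h => by simpa using hRj h
    exact ⟨{j}, R, Finset.card_singleton j, hR, Finset.disjoint_singleton_left.2 hj,
      by rw [hval, repairBandwidth_map_yeBargCode hγ hb hd hrn hf.1 hR hj]⟩
  · rintro x ⟨F, R, hF, hR, hFR, rfl⟩
    obtain ⟨j, rfl⟩ := Finset.card_eq_one.1 hF
    rw [hval, repairBandwidth_map_yeBargCode hγ hb hd hrn hf.1 hR
      (Finset.disjoint_singleton_left.1 hFR)]

end YeBarg

/-! ### Global structure and local restrictions of the code. -/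

section PMDSCode

variable {F K : Type*} [Field F] [Field K] [Algebra F K] {μ n b q r s : ℕ}
  {β : Fin n → Fin b → F} {α : Fin μ → Fin n → K}

theorem mem_pmdsCode {c : Matrix (Fin (b ^ n)) (Fin μ × Fin n) K} :
    c ∈ pmdsCode q r s β α ↔ ∀ a, pmdsParity q r s β α a *ᵥ c a = 0 := Iff.rfl

theorem pmdsCode_eq_rowCode : pmdsCode q r s β α = rowCode (pmdsParity q r s β α) :=
  Submodule.ext fun _ => mem_pmdsCode.trans mem_rowCode.symm

theorem mem_localGroup {i : Fin μ} {p : Fin μ × Fin n} : p ∈ localGroup μ n i ↔ p.1 = i := by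
  simp [localGroup]

theorem bijective_snd_localGroup (i : Fin μ) :
    Function.Bijective fun p : localGroup μ n i => p.1.2 := by
  constructor
  · rintro ⟨p, hp⟩ ⟨p', hp'⟩ h
    exact Subtype.ext (Prod.ext ((mem_localGroup.1 hp).trans (mem_localGroup.1 hp').symm) h)
  · intro k
    exact ⟨⟨(i, k), mem_localGroup.2 rfl⟩, rfl⟩

theorem card_localGroup (i : Fin μ) : (localGroup μ n i).card = n := by
  rw [← Fintype.card_coe, Fintype.card_of_bijective (bijective_snd_localGroup i), Fintype.card_fin]

theorem exists_subset_localGroup (μ : ℕ) (hrn : r ≤ n) :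
    ∃ E : Fin μ → Finset (Fin μ × Fin n), ∀ i, E i ⊆ localGroup μ n i ∧ (E i).card = r := by
  choose E hE hr using fun i : Fin μ => Finset.exists_subset_card_eq (s := localGroup μ n i) (n := r)
    (by rwa [card_localGroup])
  exact ⟨E, fun i => ⟨hE i, hr i⟩⟩

theorem restrictCode_localGroup {ℓ : ℕ} (C : Submodule K (Matrix (Fin ℓ) (Fin μ × Fin n) K))
    (i : Fin μ) : restrictCode C (localGroup μ n i) =
      (C.map (columnMap K ℓ fun k : Fin n => (i, k))).map
        (columnMap K ℓ fun p : localGroup μ n i => p.1.2) := by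
  rw [restrictCode, ← Submodule.map_comp]
  congr 1
  ext c a p
  exact congrArg (c a) (Prod.ext (mem_localGroup.1 p.2) rfl)

theorem mem_of_subset_localGroup {E : Fin μ → Finset (Fin μ × Fin n)}
    (hE : ∀ i, E i ⊆ localGroup μ n i) {p : Fin μ × Fin n} :
    p ∈ Finset.univ.biUnion E ↔ p ∈ E p.1 := by
  refine ⟨fun h => ?_, fun h => Finset.mem_biUnion.2 ⟨p.1, Finset.mem_univ _, h⟩⟩
  obtain ⟨i, -, hi⟩ := Finset.mem_biUnion.1 h
  rwa [mem_localGroup.1 (hE i hi)]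

theorem card_biUnion_of_subset_localGroup {E : Fin μ → Finset (Fin μ × Fin n)}
    (hE : ∀ i, E i ⊆ localGroup μ n i) (hr : ∀ i, (E i).card = r) :
    (Finset.univ.biUnion E).card = μ * r := by
  rw [Finset.card_biUnion, Finset.sum_congr rfl fun i _ => hr i]
  · simp
  · intro i _ j _ hij
    exact Finset.disjoint_left.2 fun p hp hp' =>
      hij ((mem_localGroup.1 (hE i hp)).symm.trans (mem_localGroup.1 (hE j hp')))

theorem card_pmds (μ r s : ℕ) : Fintype.card ((Fin μ × Fin r) ⊕ Fin s) = μ * r + s := by simp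

theorem eq_zero_of_pmdsParity_mulVec_eq_zero_of_subset [Fintype F]
    (hβ : Function.Injective fun p : Fin n × Fin b => β p.1 p.2)
    (hα : ∀ T : Finset (Fin μ × Fin n), T.card ≤ (r + 1) * s →
      LinearIndependent F fun p : T => α p.1.1 p.1.2)
    (a : Fin (b ^ n))
    {E : Fin μ → Finset (Fin μ × Fin n)} (hE : ∀ i, E i ⊆ localGroup μ n i)
    (hr : ∀ i, (E i).card = r) {T : Finset (Fin μ × Fin n)} (hT : T.card ≤ s)
    (hTE : Disjoint T (Finset.univ.biUnion E)) {c : Fin μ × Fin n → K}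
    (hc : pmdsParity (Fintype.card F) r s β α a *ᵥ c = 0)
    (hsupp : ∀ p ∉ Finset.univ.biUnion E ∪ T, c p = 0) : c = 0 := by
  classical
  have hmem : ∀ p : Fin μ × Fin n, p.2 ∈ (E p.1).image Prod.snd ↔ p ∈ Finset.univ.biUnion E := by
    intro p
    rw [mem_of_subset_localGroup hE, Finset.mem_image]
    constructor
    · rintro ⟨p', hp', h⟩
      have hpp : p' = p := Prod.ext (mem_localGroup.1 (hE _ hp')) h
      rwa [hpp] at hp'
    · exact fun h => ⟨p, h, rfl⟩
  refine eq_zero_of_pmdsParity_mulVec_eq_zero hβ hα a (E := fun i => (E i).image Prod.snd)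
    (fun i => ?_) hT (fun p hp h => ?_) hc fun p hp hpT => ?_
  · rw [Finset.card_image_of_injOn, hr i]
    intro p hp p' hp' h
    exact Prod.ext ((mem_localGroup.1 (hE i hp)).trans (mem_localGroup.1 (hE i hp')).symm) h
  · exact Finset.disjoint_left.1 hTE hp ((hmem p).1 h)
  · refine hsupp p fun h => ?_
    rcases Finset.mem_union.1 h with h | h
    · exact hp ((hmem p).2 h)
    · exact hpT h

/-- The `μ r` erased columns and any `s` others are independent in each `H^(a)`. The inequality on
`s` is strict so that the code has positive dimension and a word of weight `s + 1`. -/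
theorem isMDSArrayCode_restrictCode_compl [Fintype F]
    (hβ : Function.Injective fun p : Fin n × Fin b => β p.1 p.2)
    (hα : ∀ T : Finset (Fin μ × Fin n), T.card ≤ (r + 1) * s →
      LinearIndependent F fun p : T => α p.1.1 p.1.2)
    (hb : 0 < b) (hrn : r ≤ n) (hs : s < (n - r) * μ)
    {E : Fin μ → Finset (Fin μ × Fin n)} (hE : ∀ i, E i ⊆ localGroup μ n i ∧ (E i).card = r) :
    Module.finrank K (pmdsCode (Fintype.card F) r s β α) = b ^ n * ((n - r) * μ - s) ∧
      IsMDSArrayCode (restrictCode (pmdsCode (Fintype.card F) r s β α) (Finset.univ.biUnion E)ᶜ)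
        ((n - r) * μ) ((n - r) * μ - s) (s + 1) := by
  classical
  have hB := card_biUnion_of_subset_localGroup (fun i => (hE i).1) fun i => (hE i).2
  have hmul : μ * n = μ * r + (n - r) * μ := by
    rw [mul_comm (n - r), ← mul_add, Nat.add_sub_cancel' hrn]
  have hι : Fintype.card (Fin μ × Fin n) =
      Fintype.card ((Fin μ × Fin r) ⊕ Fin s) + ((n - r) * μ - s) := by
    rw [card_pmds, Fintype.card_prod, Fintype.card_fin, Fintype.card_fin]
    omega
  have h := isMDSArrayCode_map_rowCode (A := pmdsParity (Fintype.card F) r s β α)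
    (f := fun p : ((Finset.univ.biUnion E)ᶜ : Finset (Fin μ × Fin n)) => p.1)
    (k := (n - r) * μ - s) (s := s) Subtype.val_injective (pow_pos hb n) (by omega) hι ?_ ?_
  · rw [Nat.sub_add_cancel hs.le, ← pmdsCode_eq_rowCode] at h
    refine ⟨?_, h.2⟩
    rw [pmdsCode_eq_rowCode]
    exact finrank_rowCode h.1 hι
  · rw [Fintype.card_coe, Finset.card_compl, hB, Fintype.card_prod, Fintype.card_fin,
      Fintype.card_fin]
    omega
  · intro a c hc T hT hcT
    refine eq_zero_of_pmdsParity_mulVec_eq_zero_of_subset hβ hα a (fun i => (hE i).1)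
      (fun i => (hE i).2) (T := T.map (Function.Embedding.subtype _)) (by rwa [Finset.card_map])
      ?_ hc ?_
    · refine Finset.disjoint_left.2 fun p hp hp' => ?_
      obtain ⟨p, -, rfl⟩ := Finset.mem_map.1 hp
      exact Finset.mem_compl.1 p.2 hp'
    · intro p hp
      rw [Finset.mem_union, not_or] at hp
      exact hcT ⟨p, Finset.mem_compl.2 hp.1⟩ fun h => hp.2 (Finset.mem_map.2 ⟨_, h, rfl⟩)

/-- The last `s` parity checks can be met using positions outside group `i`, so they impose nothing
on that group. -/
theorem map_pmdsCode_eq_yeBargCode [Fintype F]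
    (hβ : Function.Injective fun p : Fin n × Fin b => β p.1 p.2)
    (hα : ∀ T : Finset (Fin μ × Fin n), T.card ≤ (r + 1) * s →
      LinearIndependent F fun p : T => α p.1.1 p.1.2)
    (hrn : r ≤ n) (hs : s ≤ (n - r) * (μ - 1)) (i : Fin μ) :
    (pmdsCode (Fintype.card F) r s β α).map (columnMap K (b ^ n) fun k : Fin n => (i, k)) =
      yeBargCode r fun k j => algebraMap F K (β k j) := by
  classical
  have hparity : ∀ (a : Fin (b ^ n)) (c : Fin μ × Fin n → K) (t : Fin r),
      (pmdsParity (Fintype.card F) r s β α a *ᵥ c) (Sum.inl (i, t)) =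
        (yeBargParity r (fun k j => algebraMap F K (β k j)) a *ᵥ fun k => c (i, k)) t :=
    fun a c t => pmdsParity_mulVec_inl ..
  obtain ⟨E, hE⟩ := exists_subset_localGroup (r := r) (n := n) μ hrn
  set B := Finset.univ.biUnion E with hB
  have hBcard : B.card = μ * r :=
    card_biUnion_of_subset_localGroup (fun i => (hE i).1) fun i => (hE i).2
  -- Outside `B` and group `i` there remain `(n - r)(μ - 1)` positions, enough for `T`.
  have hout : s ≤ ((B ∪ localGroup μ n i)ᶜ).card := by
    have h1 := Finset.card_union_add_card_inter B (localGroup μ n i)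
    have h2 : B ∩ localGroup μ n i = E i := by
      ext p
      rw [Finset.mem_inter, hB, mem_of_subset_localGroup fun i => (hE i).1, mem_localGroup]
      constructor
      · rintro ⟨h, rfl⟩
        exact h
      · intro h
        have := mem_localGroup.1 ((hE i).1 h)
        exact ⟨by rwa [this], this⟩
    rw [h2, hBcard, (hE i).2, card_localGroup] at h1
    rw [Finset.card_compl, Fintype.card_prod, Fintype.card_fin, Fintype.card_fin]
    obtain ⟨ν, rfl⟩ : ∃ ν, μ = ν + 1 := ⟨μ - 1, by have := i.2; omega⟩
    obtain ⟨k, rfl⟩ := Nat.exists_eq_add_of_le hrn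
    simp only [Nat.add_sub_cancel, Nat.add_sub_cancel_left] at hs
    have : (ν + 1) * (r + k) = (ν + 1) * r + k * ν + k := by ring
    omega
  obtain ⟨T, hTsub, hT⟩ := Finset.exists_subset_card_eq hout
  have hTB : Disjoint T B := Finset.disjoint_left.2 fun p hp hp' =>
    Finset.mem_compl.1 (hTsub hp) (Finset.mem_union_left _ hp')
  apply le_antisymm
  · rintro _ ⟨c, hc, rfl⟩
    refine mem_yeBargCode.2 fun a => funext fun t => ?_
    exact (hparity a (c a) t).symm.trans (congrFun (mem_pmdsCode.1 hc a) _)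
  · intro x hx
    set y : Matrix (Fin (b ^ n)) (Fin μ × Fin n) K := fun a p => if p.1 = i then x a p.2 else 0
      with hy
    -- Extend `x` by zero to `y` and cancel its syndrome by a vector on `B ∪ T`, whose columns are
    -- invertible.
    have hz : ∀ a, ∃ z : Fin μ × Fin n → K, (∀ p ∉ B ∪ T, z p = 0) ∧
        pmdsParity (Fintype.card F) r s β α a *ᵥ z =
          -(pmdsParity (Fintype.card F) r s β α a *ᵥ y a) := by
      intro a
      refine exists_supported_mulVec_eq ?_ (fun c hcs hc => ?_) _
      · rw [Finset.card_union_of_disjoint hTB.symm, card_pmds, hBcard, hT]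
      · exact eq_zero_of_pmdsParity_mulVec_eq_zero_of_subset hβ hα a (fun i => (hE i).1)
          (fun i => (hE i).2) hT.le hTB hc hcs
    choose z hzs hz using hz
    have hyi : ∀ a, (fun k => y a (i, k)) = x a := fun a => funext fun k => by simp [hy]
    -- Within group `i` the correction lives on `E i` and has zero local syndrome, because `x`
    -- already satisfies the local checks; Vandermonde then forces it to vanish.
    have hzi : ∀ a k, z a (i, k) = 0 := by
      intro a k
      have hz0 : ∀ k, (i, k) ∉ E i → z a (i, k) = 0 := by
        intro k hk
        refine hzs a _ fun h => ?_
        rcases Finset.mem_union.1 h with h | h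
        · exact hk ((mem_of_subset_localGroup fun i => (hE i).1).1 h)
        · exact Finset.mem_compl.1 (hTsub h) (Finset.mem_union_right _ (mem_localGroup.2 rfl))
      by_cases hk : (i, k) ∈ E i
      · refine eq_zero_of_sum_pow_mul_eq_zero (S := (E i).image Prod.snd) (r := r)
          (x := fun k => algebraMap F K (digitNode β a k)) (c := fun k => z a (i, k))
          ((algebraMap F K).injective.comp (digitNode_injective hβ a)).injOn
          (Finset.card_image_le.trans (hE i).2.le) (fun t ht => ?_) k
          (Finset.mem_image_of_mem Prod.snd hk)
        rw [Finset.sum_subset (Finset.subset_univ _) fun l _ hl => by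
          rw [hz0 l fun h => hl (Finset.mem_image_of_mem Prod.snd h), mul_zero],
          ← pmdsParity_mulVec_inl (Fintype.card F) r s β α a (z a) i ⟨t, ht⟩, hz a, Pi.neg_apply,
          hparity, hyi, mem_yeBargCode.1 hx a, Pi.zero_apply, neg_zero]
      · exact hz0 k hk
    refine ⟨fun a => y a + z a, mem_pmdsCode.2 fun a => ?_, ?_⟩
    · rw [Matrix.mulVec_add, hz a, add_neg_cancel]
    · ext a k
      change y a (i, k) + z a (i, k) = x a k
      rw [hzi, add_zero]
      exact congrFun (hyi a) k

end PMDSCode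

theorem mainTheorem3 {F K : Type*} [Field F] [Finite F] [Field K] [Finite K] [Algebra F K]
    (q M μ n r s d b : ℕ)
    (hF : Nat.card F = q) (hK : Nat.card K = q ^ M)
    (hr : 0 < r) (hrn : r ≤ n) (hs : 0 < s) (hsn : s ≤ (n - r) * (μ - 1))
    (hd : n - r ≤ d) (hdn : d < n) (hb : b = d + 1 - (n - r))
    (β : Fin n → Fin b → F)
    (hβ : Function.Injective fun p : Fin n × Fin b => β p.1 p.2)
    (α : Fin μ → Fin n → K)
    (hα : ∀ T : Finset (Fin μ × Fin n), T.card ≤ (r + 1) * s →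
      LinearIndependent F fun p : T => α p.1.1 p.1.2) :
    IsLocallyMSRPMDSWith (pmdsCode q r s β α) (localGroup μ n) n r s 1 d ∧
      ∀ i : Fin μ,
        (pmdsCode q r s β α).map (columnMap K (b ^ n) fun k : Fin n => (i, k)) =
          yeBargCode r fun k j => algebraMap F K (β k j) := by
  have := Fintype.ofFinite F
  rw [Nat.card_eq_fintype_card] at hF
  subst hF
  have hb0 : 0 < b := by omega
  have hpos : 0 < (n - r) * (μ - 1) := hs.trans_le hsn
  have hrn' : r < n := by
    have := Nat.pos_of_mul_pos_right hpos
    omega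
  have hμ : 0 < μ := by
    have := Nat.pos_of_mul_pos_left hpos
    omega
  have hlt : s < (n - r) * μ :=
    hsn.trans_lt (Nat.mul_lt_mul_of_pos_left (by omega) (by omega))
  have hmap := map_pmdsCode_eq_yeBargCode hβ hα hrn hsn
  have hγ : Function.Injective fun p : Fin n × Fin b => algebraMap F K (β p.1 p.2) :=
    (algebraMap F K).injective.comp hβ
  have hMSR : ∀ i, IsMSR (restrictCode (pmdsCode (Fintype.card F) r s β α) (localGroup μ n i))
      n r 1 d := by
    intro i
    rw [restrictCode_localGroup, hmap i]
    exact isMSR_map_yeBargCode hγ hb0 hr hrn' hdn (by omega) (bijective_snd_localGroup i)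
  obtain ⟨E, hE⟩ := exists_subset_localGroup (r := r) (n := n) μ hrn
  refine ⟨⟨?_, hMSR⟩, hmap⟩
  exact
    { pos_mu := hμ
      pos_n := by omega
      pos_r := hr
      pos_s := hs
      pos_l := pow_pos hb0 n
      r_le := hrn
      s_le := hlt.le
      length_eq := by simp
      finrank_eq := (isMDSArrayCode_restrictCode_compl hβ hα hb0 hrn hlt hE).1
      disjoint := fun i j hij => Finset.disjoint_left.2 fun p hp hp' =>
        hij ((mem_localGroup.1 hp).symm.trans (mem_localGroup.1 hp'))
      cover := fun p => ⟨p.1, mem_localGroup.2 rfl⟩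
      card_group := card_localGroup
      local_mds := fun i => (hMSR i).2.2.2.2.1
      global_mds := fun E hE => (isMDSArrayCode_restrictCode_compl hβ hα hb0 hrn hlt hE).2 }
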